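/- Consider the two-user erasure broadcast channel with intermittent feedback. At each time $t=1,\dots,n$ the transmitter sends $X[t]\in\mathbb F_2$ and receiver $i\in\{1,2\}$ obtains $Y_i[t]=S_i[t]X[t]$ together with $S_i[t]\in\{0,1\}$. Receiver $i$ feeds back $S_i[t]$; this reaches the transmitter iff $S_{FiT}[t]=1$ and the other receiver $\bar i$ iff $S_{Fi\bar i}[t]=1$. The forward states $(S_1[t],S_2[t])$ and the feedback states $(S_{F1T}[t],S_{F12}[t],S_{F2T}[t],S_{F21}[t])$ each have an arbitrary joint law; both processes are i.i.d. over time, independent of each other and of the messages. The messages $W_1,W_2$ are independent and uniform on sets of $\lceil 2^{nR_1}\rceil$ and $\lceil 2^{nR_2}\rceil$ elements, $R_1,R_2\ge 0$. The input $X[t]$ is a function of $W_1,W_2$ and of $S_{FiT}[s]$, $S_{FiT}[s]S_i[s]$ for $s<t$, $i=1,2$. Receiver $i$ estimates $W_i$ as a function of $Y_i[t]$, $S_i[t]$, $S_{FiT}[t]$, $S_{F\bar i i}[t]$, $S_{F\bar i i}[t]S_{\bar i}[t]$, $t=1,\dots,n$. A pair $(R_1,R_2)$ is achievable if there are such codes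 of all block lengths $n$ for which both average error probabilities tend to $0$ as $n\to\infty$, and the capacity region is the closure of the set of achievable pairs. Theorem. Suppose that $S_{FiT}[t]=S_{Fi\bar i}[t]$ almost surely for $i=1,2$, that $$P(S_1[t]=0)=P(S_2[t]=0)=\delta,\qquad P(S_{F1T}[t]S_{F12}[t]=0)=P(S_{F2T}[t]S_{F21}[t]=0)=\delta,$$ and that $P(S_{F1T}[t]=S_{F2T}[t]=0)=P(S_1[t]=S_2[t]=0)=\delta^2$. Then the rate pair $$R_1=R_2=\frac{1-\delta^2}{2+\delta+\delta^3}$$ can be achieved, in the sense that it belongs to the capacity region of the channel. -/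

import Mathlib

open MeasureTheory Filter Topology

noncomputable section

namespace IntermittentBC

/-- The two receivers `Rx₁`, `Rx₂` are indexed by `0, 1 : Fin 2`. -/
abbrev User : Type := Fin 2

/-- The other receiver: `other 0 = 1`, `other 1 = 0`. -/
def other : User → User := ![1, 0]

/-- Forward channel state at one time instant: `s i` is `S_i[t]`, where `true` means that receiver
`i` gets the channel input and `false` means an erasure. -/
abbrev ForwardState : Type := User → Bool

/-- Feedback state at one time instant: `f.1 i` is the state `S_{FiT}[t]` of the link from receiver
`i` to the transmitter, and `f.2 i` is the state `S_{Fi ī}[t]` of the link from receiver `i` to the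
other receiver; `false` means an erasure. -/
abbrev FeedbackState : Type := (User → Bool) × (User → Bool)

/-- The state of all the links at one time instant. -/
abbrev State : Type := ForwardState × FeedbackState

/-- A two-user erasure broadcast channel with intermittent feedback. The states of the two forward
links have an arbitrary joint law, and so have the states of the four feedback links. The forward
and feedback processes are i.i.d. over time and independent of each other. -/
structure Channel where
  /-- Joint law of `(S_1[t], S_2[t])`. -/
  forwardLaw : PMF ForwardState
  /-- Joint law of `(S_{F1T}[t], S_{F2T}[t])` and `(S_{F12}[t], S_{F21}[t])`. -/
  feedbackLaw : PMF FeedbackState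

namespace Channel

/-- The law of the link states at one time instant. -/
def stateLaw (C : Channel) : Measure State :=
  C.forwardLaw.toMeasure.prod C.feedbackLaw.toMeasure

/-- The law of the link states over `n` channel uses. -/
def blockLaw (C : Channel) (n : ℕ) : Measure (Fin n → State) :=
  Measure.pi fun _ => C.stateLaw

/-- `δ_i = P(S_i[t] = 0)`. -/
def erasure (C : Channel) (i : User) : ℝ :=
  C.forwardLaw.toMeasure.real {s | s i = false}

/-- `δ_{12} = P(S_1[t] = 0, S_2[t] = 0)`. -/
def jointErasure (C : Channel) : ℝ :=
  C.forwardLaw.toMeasure.real {s | s 0 = false ∧ s 1 = false}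

/-- `δ_{Fi} = P(S_{FiT}[t] S_{Fi ī}[t] = 0)`. -/
def feedbackErasure (C : Channel) (i : User) : ℝ :=
  C.feedbackLaw.toMeasure.real {f | (f.1 i && f.2 i) = false}

/-- `δ_{FF} = P(S_{F1T}[t] = S_{F2T}[t] = 0)`. -/
def jointFeedbackErasure (C : Channel) : ℝ :=
  C.feedbackLaw.toMeasure.real {f | f.1 0 = false ∧ f.1 1 = false}

end Channel

/-- A block code of length `n` for a message `W_i` from a set of `M i` messages for each receiver
`i`. -/
structure Code (n : ℕ) (M : User → ℕ) where
  /-- The channel input at time `t`, a function of both messages and of what the transmitter knows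
  of the past: `(S_{FiT}[s])_{s < t}` and `(S_{FiT}[s] S_i[s])_{s < t}`, `i = 1, 2`. -/
  encode : (t : Fin n) → ((i : User) → Fin (M i)) →
    (fbStates : Fin t → User → Bool) → (fbValues : Fin t → User → Bool) → ZMod 2
  /-- The estimate of `W_i` at receiver `i`, a function of `Y_i^n`, of `S_i^n`, of
  `S_{Fi}^n = (S_{FiT}, S_{F ī i})^n` and of `(S_{F ī i} S_ī)^n`. -/
  decode : (i : User) → (output : Fin n → ZMod 2) → (csi : Fin n → Bool) →
    (fbStates : Fin n → Bool × Bool) → (fbValues : Fin n → Bool) → Fin (M i)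

namespace Code

variable {n : ℕ} {M : User → ℕ}

/-- The channel input `X[t]` when the messages are `w` and the link states are `σ`. -/
def input (c : Code n M) (w : (i : User) → Fin (M i)) (σ : Fin n → State) (t : Fin n) : ZMod 2 :=
  c.encode t w
    (fun s i => (σ (Fin.castLE t.isLt.le s)).2.1 i)
    (fun s i => (σ (Fin.castLE t.isLt.le s)).2.1 i && (σ (Fin.castLE t.isLt.le s)).1 i)

/-- The received signal `Y_i[t] = S_i[t] X[t]`. -/
def output (c : Code n M) (w : (i : User) → Fin (M i)) (σ : Fin n → State) (i : User)
    (t : Fin n) : ZMod 2 :=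
  if (σ t).1 i then c.input w σ t else 0

/-- The estimate of `W_i` at receiver `i` when the messages are `w` and the link states are `σ`. -/
def estimate (c : Code n M) (w : (i : User) → Fin (M i)) (σ : Fin n → State) (i : User) :
    Fin (M i) :=
  c.decode i (c.output w σ i) (fun t => (σ t).1 i)
    (fun t => ((σ t).2.1 i, (σ t).2.2 (other i)))
    (fun t => (σ t).2.2 (other i) && (σ t).1 (other i))

/-- The average probability of error `λ_{i,n}` at receiver `i`: the messages are independent,
uniform, and independent of the link states. -/
def errorProb (c : Code n M) (C : Channel) (i : User) : ℝ :=
  (∑ w : (j : User) → Fin (M j), (C.blockLaw n).real {σ | c.estimate w σ i ≠ w i}) /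
    (∏ j, (M j : ℝ))

end Code

namespace Channel

/-- `(R₁, R₂)` is achievable: there are codes of all block lengths `n`, with `2 ^ (n R_i)` messages
(rounded up) for receiver `i`, whose error probabilities tend to `0`. -/
def Achievable (C : Channel) (R : ℝ × ℝ) : Prop :=
  0 ≤ R.1 ∧ 0 ≤ R.2 ∧
    ∃ c : (n : ℕ) → Code n ![⌈(2 : ℝ) ^ ((n : ℝ) * R.1)⌉₊, ⌈(2 : ℝ) ^ ((n : ℝ) * R.2)⌉₊],
      ∀ i, Tendsto (fun n => (c n).errorProb C i) atTop (𝓝 0)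

/-- The capacity region: the closure of the set of achievable rate pairs. -/
def capacityRegion (C : Channel) : Set (ℝ × ℝ) :=
  closure {R | C.Achievable R}

end Channel

end IntermittentBC

end

/-!
The rate is achieved by random linear codes over `ZMod 2` in three phases. In the first `N` slots
the transmitter sends fresh packets for user `0`, which are random linear combinations of the `K`
bits of its message, in the next `N` slots it does the same for user `1`, and in the remaining `T`
slots it sends random linear combinations of recycled packets of both users. A packet of user `i` is
recycled if the other receiver has reported its reception, or if receiver `i` has reported an erasure
while the report of the other receiver was lost. As a report reaches the other receiver whenever it
reaches the transmitter, both receivers know which packets are recycled.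

Receiver `i` treats the recycled packets of the other user as further unknowns. It can decode if the
packets of its own user that it has heard or that are recycled number at least `K`, and if the
packets of its own user and the mixed slots that it hears outnumber `K` plus the number of recycled
packets of the other user that it has missed (`card_collision_le`, `card_estimate_ne_le`). The first
count is about `(1 - δ ^ 2) * N`, by `stateLaw_real_heard_or_reusable`, and the number of missed
recycled packets is about `δ ^ 3 * (1 - δ) * N`, by `stateLaw_real_reusable_and_missed`. With
`K = (1 - δ ^ 2) * N` the second condition reads
`(1 - δ) * (N + T) ≥ (1 - δ ^ 2) * N + δ ^ 3 * (1 - δ) * N`, that is `T = (δ + δ ^ 3) * N`, and the rate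
`K / (2 * N + T)` is `(1 - δ ^ 2) / (2 + δ + δ ^ 3)`. Chebyshev's inequality controls the deviations of
the counts (`measureReal_not_typical_le`), and averaging over the coefficients yields a good
deterministic code (`exists_code_errorProb_le`).
-/

open MeasureTheory Filter Topology

noncomputable section

namespace IntermittentBC

/-! ### Counting random linear equations over `ZMod 2` -/

open Finset in
theorem card_dotProduct_eq_zero {κ : Type*} [Fintype κ] [DecidableEq κ] {x : κ → ZMod 2}
    (hx : x ≠ 0) :
    2 * #{g : κ → ZMod 2 | g ⬝ᵥ x = 0} = Fintype.card (κ → ZMod 2) := by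
  obtain ⟨k, hk⟩ := Function.ne_iff.1 hx
  have hk1 : x k = 1 := (by decide : ∀ a : ZMod 2, a ≠ 0 → a = 1) _ hk
  have hcard : #{g : κ → ZMod 2 | g ⬝ᵥ x = 0} = #{g : κ → ZMod 2 | ¬ g ⬝ᵥ x = 0} := by
    refine card_equiv (Equiv.addRight (Pi.single k 1)) fun g => ?_
    have h3 : ∀ a : ZMod 2, a = 0 ↔ ¬ (a + 1 = 0) := by decide
    simp [add_dotProduct, hk1, ← h3]
  have := card_filter_add_card_filter_not (s := (univ : Finset (κ → ZMod 2)))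
    (fun g => g ⬝ᵥ x = 0)
  rw [← card_univ]
  omega

open Finset in
/-- A uniformly random matrix annihilates `x ≠ 0` in the rows of `S` with probability `2 ^ (-#S)`. -/
theorem card_forall_dotProduct_eq_zero {ι κ : Type*} [Fintype ι] [DecidableEq ι] [Fintype κ]
    [DecidableEq κ] {x : κ → ZMod 2} (hx : x ≠ 0) (S : Finset ι) :
    (#{G : ι → κ → ZMod 2 | ∀ s ∈ S, G s ⬝ᵥ x = 0} : ℝ) =
      (1 / 2) ^ #S * Fintype.card (ι → κ → ZMod 2) := by
  have h : ({G : ι → κ → ZMod 2 | ∀ s ∈ S, G s ⬝ᵥ x = 0} : Finset _) =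
      Fintype.piFinset fun s => if s ∈ S then ({g : κ → ZMod 2 | g ⬝ᵥ x = 0} : Finset _)
        else univ := by
    ext G
    simp only [mem_filter, mem_univ, true_and, Fintype.mem_piFinset]
    refine forall_congr' fun s => ?_
    by_cases hs : s ∈ S <;> simp [hs]
  have h1 : (#{g : κ → ZMod 2 | g ⬝ᵥ x = 0} : ℝ) = 1 / 2 * Fintype.card (κ → ZMod 2) := by
    rw [← card_dotProduct_eq_zero hx]; push_cast; ring
  have h2 : ∀ s : ι, ((#(if s ∈ S then ({g : κ → ZMod 2 | g ⬝ᵥ x = 0} : Finset _)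
        else univ) : ℕ) : ℝ) = (if s ∈ S then 1 / 2 else 1) * Fintype.card (κ → ZMod 2) := by
    intro s
    by_cases hs : s ∈ S <;> simp only [hs, if_true, if_false, h1, one_mul, card_univ]
  rw [h, Fintype.card_piFinset, Nat.cast_prod, prod_congr rfl fun s _ => h2 s,
    prod_mul_distrib, prod_ite_mem, univ_inter, prod_const, prod_const, card_univ,
    Fintype.card_fun (α := ι)]
  push_cast
  rfl

open Finset in
theorem card_supported_le {ι : Type*} [Fintype ι] [DecidableEq ι] (U : Finset ι) :
    #{e : ι → ZMod 2 | ∀ s ∉ U, e s = 0} ≤ 2 ^ #U := by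
  have h : ({e : ι → ZMod 2 | ∀ s ∉ U, e s = 0} : Finset _) =
      Fintype.piFinset fun s => if s ∈ U then (univ : Finset (ZMod 2)) else {0} := by
    ext G
    simp only [mem_filter, mem_univ, true_and, Fintype.mem_piFinset]
    refine forall_congr' fun s => ?_
    by_cases hs : s ∈ U <;> simp [hs]
  rw [h, Fintype.card_piFinset]
  have : ∀ s : ι, #(if s ∈ U then (univ : Finset (ZMod 2)) else {0}) = if s ∈ U then 2 else 1 := by
    intro s
    by_cases hs : s ∈ U <;> simp [hs, ZMod.card]
  simp [this, prod_ite_mem]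

/-- The difference of two hypotheses of receiver `i` on the packets that enter the mixed slots: its
own packets, from the slots of `V`, differ by the coded bits of the message difference `d`, and the
packets of the other user differ by an arbitrary vector `e`. Packets are indexed by the user they
are intended for and the slot in which they were first sent. -/
def mixedVector {ι : Type*} [Fintype ι] {n : ℕ} (i : User) (V : Finset (Fin n))
    (G : User × Fin n → ι → ZMod 2) (d : ι → ZMod 2) (e : Fin n → ZMod 2) (p : User × Fin n) :
    ZMod 2 :=
  if p.1 = i then (if p.2 ∈ V then G (i, p.2) ⬝ᵥ d else 0) else e p.2

/-- The message difference `d` of user `i` is invisible to receiver `i` under the coefficients `G`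
of the packets and `P` of the mixed slots. Here `H` is the set of slots whose fresh packets of user
`i` receiver `i` has heard, `V` the set of slots whose packets of user `i` enter the mixed slots, `U`
the set of slots whose packets of the other user enter the mixed slots without having been heard by
receiver `i`, and `T` the set of mixed slots that it has heard. -/
def Collision {ι : Type*} [Fintype ι] {n : ℕ} (i : User) (H V U T : Finset (Fin n)) (d : ι → ZMod 2)
    (G : User × Fin n → ι → ZMod 2) (P : Fin n → User × Fin n → ZMod 2) : Prop :=
  (∀ s ∈ H, G (i, s) ⬝ᵥ d = 0) ∧
    ∃ e : Fin n → ZMod 2, (∀ s ∉ U, e s = 0) ∧ ∀ t ∈ T, P t ⬝ᵥ mixedVector i V G d e = 0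

open Finset Classical in
/-- Either `G d` vanishes on all of `H ∪ V`, or it vanishes on `H` only; in the latter case
`mixedVector` is nonzero whatever `e` is, so that each of the at most `2 ^ #U` choices of `e`
survives the `#T` random equations of the mixed slots with probability `2 ^ (-#T)`. -/
theorem card_collision_le {ι : Type*} [Fintype ι] [DecidableEq ι] {n : ℕ} (i : User)
    (H V U T : Finset (Fin n)) {d : ι → ZMod 2} (hd : d ≠ 0) :
    (#{ω : (User × Fin n → ι → ZMod 2) × (Fin n → User × Fin n → ZMod 2) |
      Collision i H V U T d ω.1 ω.2} : ℝ) ≤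
      ((1 / 2) ^ #(H ∪ V) + (1 / 2) ^ #H * (2 ^ #U * (1 / 2) ^ #T)) *
        Fintype.card ((User × Fin n → ι → ZMod 2) × (Fin n → User × Fin n → ZMod 2)) := by
  set Γ := User × Fin n → ι → ZMod 2
  set Ψ := Fin n → User × Fin n → ZMod 2
  have key : ∀ G : Γ, (#{P : Ψ | Collision i H V U T d G P} : ℝ) ≤
      (if ∀ s ∈ ({i} ×ˢ (H ∪ V) : Finset (User × Fin n)), G s ⬝ᵥ d = 0 then 1 else 0) *
          (Fintype.card Ψ : ℝ) +
        (if ∀ s ∈ ({i} ×ˢ H : Finset (User × Fin n)), G s ⬝ᵥ d = 0 then 1 else 0) *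
          (2 ^ #U * (1 / 2) ^ #T * (Fintype.card Ψ : ℝ)) := by
    intro G
    by_cases hH : ∀ s ∈ ({i} ×ˢ H : Finset (User × Fin n)), G s ⬝ᵥ d = 0
    swap
    · have h0 : #{P : Ψ | Collision i H V U T d G P} = 0 := by
        rw [card_eq_zero, filter_eq_empty_iff]
        rintro P - ⟨hP, -⟩
        exact hH (by simpa using hP)
      rw [h0, if_neg hH, Nat.cast_zero]
      positivity
    by_cases hV : ∀ s ∈ ({i} ×ˢ (H ∪ V) : Finset (User × Fin n)), G s ⬝ᵥ d = 0
    · rw [if_pos hV, one_mul]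
      have : (#{P : Ψ | Collision i H V U T d G P} : ℝ) ≤ Fintype.card Ψ := by
        exact_mod_cast card_le_univ _
      refine this.trans (le_add_of_nonneg_right ?_)
      positivity
    have hv : ∀ e, mixedVector i V G d e ≠ 0 := by
      intro e he
      refine hV ?_
      rintro ⟨j, s⟩ hs
      simp only [mem_product, mem_singleton, mem_union] at hs
      obtain ⟨rfl, hs | hs⟩ := hs
      · exact hH _ (by simpa using hs)
      · simpa [mixedVector, hs] using congrFun he (j, s)
    rw [if_neg hV, if_pos hH, zero_mul, zero_add, one_mul]
    have hsub : ({P : Ψ | Collision i H V U T d G P} : Finset Ψ) ⊆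
        ({e : Fin n → ZMod 2 | ∀ s ∉ U, e s = 0} : Finset _).biUnion fun e =>
          {P : Ψ | ∀ t ∈ T, P t ⬝ᵥ mixedVector i V G d e = 0} := by
      intro P hP
      simp only [mem_filter, mem_univ, true_and, mem_biUnion] at hP ⊢
      exact hP.2
    calc (#{P : Ψ | Collision i H V U T d G P} : ℝ)
        ≤ ∑ e ∈ ({e : Fin n → ZMod 2 | ∀ s ∉ U, e s = 0} : Finset _),
            (#{P : Ψ | ∀ t ∈ T, P t ⬝ᵥ mixedVector i V G d e = 0} : ℝ) := by
          exact_mod_cast (card_le_card hsub).trans card_biUnion_le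
      _ = #{e : Fin n → ZMod 2 | ∀ s ∉ U, e s = 0} * ((1 / 2) ^ #T * (Fintype.card Ψ : ℝ)) := by
          rw [sum_congr rfl fun e _ => ?_, sum_const, nsmul_eq_mul]
          convert card_forall_dotProduct_eq_zero (hv e) T
      _ ≤ 2 ^ #U * ((1 / 2) ^ #T * (Fintype.card Ψ : ℝ)) := by
          gcongr
          exact_mod_cast
            (by convert card_supported_le U : #{e : Fin n → ZMod 2 | ∀ s ∉ U, e s = 0} ≤ 2 ^ #U)
      _ = _ := by ring
  have hG : ∀ S : Finset (Fin n),
      ∑ G : Γ, (if ∀ s ∈ ({i} ×ˢ S : Finset (User × Fin n)), G s ⬝ᵥ d = 0 then (1 : ℝ) else 0) =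
        (1 / 2) ^ #S * Fintype.card Γ := by
    intro S
    rw [sum_boole]
    have := card_forall_dotProduct_eq_zero hd ({i} ×ˢ S : Finset (User × Fin n))
    rw [card_product, card_singleton, one_mul] at this
    convert this
  calc (#{ω : Γ × Ψ | Collision i H V U T d ω.1 ω.2} : ℝ)
      = ∑ G : Γ, (#{P : Ψ | Collision i H V U T d G P} : ℝ) := by
        simp only [card_filter, Nat.cast_sum, Fintype.sum_prod_type]
    _ ≤ _ := sum_le_sum fun G _ => key G
    _ = _ := by
        rw [sum_add_distrib, ← sum_mul, ← sum_mul, hG, hG, Fintype.card_prod]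
        push_cast
        ring

/-! ### Concentration of the number of hits -/

open Classical in
/-- The slots of `I` at which the sequence `σ` of states lies in `B`. -/
def hits {α : Type*} {n : ℕ} (I : Finset (Fin n)) (B : Set α) (σ : Fin n → α) : Finset (Fin n) :=
  {t ∈ I | σ t ∈ B}

theorem mem_hits {α : Type*} {n : ℕ} {I : Finset (Fin n)} {B : Set α} {σ : Fin n → α}
    {t : Fin n} : t ∈ hits I B σ ↔ t ∈ I ∧ σ t ∈ B := by
  simp [hits]

theorem hits_union {α : Type*} {n : ℕ} (I : Finset (Fin n)) (A B : Set α) (σ : Fin n → α) :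
    hits I (A ∪ B) σ = hits I A σ ∪ hits I B σ := by
  ext t
  simp only [mem_hits, Finset.mem_union, Set.mem_union]
  tauto

open ProbabilityTheory Finset in
/-- A quantitative weak law of large numbers, by Chebyshev's inequality. -/
theorem measureReal_abs_count_sub_ge_le {α : Type*} [MeasurableSpace α] [DiscreteMeasurableSpace α]
    (μ : Measure α) [IsProbabilityMeasure μ] {n : ℕ} (hn : 0 < n) (B : Set α)
    (I : Finset (Fin n)) {ε : ℝ} (hε : 0 < ε) :
    (Measure.pi fun _ : Fin n => μ).real
        {σ | ε * n ≤ |(#(hits I B σ) : ℝ) - μ.real B * #I|} ≤ 1 / (ε ^ 2 * n) := by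
  set ν := Measure.pi fun _ : Fin n => μ
  let X : Fin n → (Fin n → α) → ℝ := fun t σ => B.indicator 1 (σ t)
  have hXm : ∀ t, Measurable (X t) := fun t =>
    (Measurable.of_discrete (f := B.indicator (1 : α → ℝ))).comp (measurable_pi_apply t)
  have hX01 : ∀ t σ, X t σ ∈ Set.Icc (0 : ℝ) 1 := by
    intro t σ
    by_cases h : σ t ∈ B <;> simp [X, h]
  have hL : ∀ t, MemLp (X t) 2 ν := fun t =>
    MemLp.of_bound (hXm t).aestronglyMeasurable 1 (ae_of_all _ fun σ => by
      rw [Real.norm_eq_abs, abs_of_nonneg (hX01 t σ).1]; exact (hX01 t σ).2)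
  have hsum : ∀ σ, (#(hits I B σ) : ℝ) = (∑ t ∈ I, X t) σ := by
    intro σ
    classical simp [X, hits, Set.indicator_apply, Finset.sum_apply]
  have hmean : ν[∑ t ∈ I, X t] = μ.real B * #I := by
    have h1 : ∀ t, ν[X t] = μ.real B := by
      intro t
      calc ν[X t] = ∫ x, B.indicator 1 x ∂(ν.map (Function.eval t)) := by
            rw [integral_map (measurable_pi_apply t).aemeasurable
              (Measurable.of_discrete).aestronglyMeasurable]
        _ = μ.real B := by
            rw [(measurePreserving_eval (fun _ : Fin n => μ) t).map_eq,
              integral_indicator_one .of_discrete]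
    simp only [Finset.sum_apply]
    rw [integral_finsetSum _ fun t _ => (hL t).integrable (by norm_num)]
    simp [h1, mul_comm]
  have hvar : Var[∑ t ∈ I, X t; ν] ≤ n := by
    rw [IndepFun.variance_sum (fun t _ => hL t)]
    · calc ∑ t ∈ I, Var[X t; ν] ≤ ∑ t ∈ I, (1 : ℝ) := by
            refine sum_le_sum fun t _ => ?_
            refine (variance_le_sq_of_bounded (ae_of_all _ (hX01 t)) (hXm t).aemeasurable).trans ?_
            norm_num
        _ ≤ n := by
            simp only [sum_const, nsmul_eq_mul, mul_one]
            exact_mod_cast (card_le_univ I).trans (by simp)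
    · intro s _ t _ hst
      exact (iIndepFun_pi (X := fun _ : Fin n => B.indicator (1 : α → ℝ))
        (μ := fun _ : Fin n => μ) fun _ => Measurable.of_discrete.aemeasurable).indepFun hst
  have hn' : (0 : ℝ) < n := by exact_mod_cast hn
  have := meas_ge_le_variance_div_sq (memLp_finsetSum' I fun t _ => hL t)
    (c := ε * n) (μ := ν) (by positivity)
  rw [hmean] at this
  simp only [hsum]
  refine (ENNReal.toReal_mono ENNReal.ofReal_ne_top this).trans ?_
  rw [ENNReal.toReal_ofReal (div_nonneg (variance_nonneg _ _) (by positivity))]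
  calc Var[∑ t ∈ I, X t; ν] / (ε * n) ^ 2 ≤ n / (ε * n) ^ 2 := by gcongr
    _ = _ := by field_simp

/-! ### The linear code -/

/-- The slots in which fresh packets of user `j` are sent: the first `N` slots for user `0` and the
next `N` slots for user `1`. -/
def ownSlots (n N : ℕ) (j : User) : Finset (Fin n) :=
  {t | j * N ≤ (t : ℕ) ∧ (t : ℕ) < (j + 1) * N}

/-- The slots in which sums of recycled packets of both users are sent: all slots from `2 * N` on. -/
def mixedSlots (n N : ℕ) : Finset (Fin n) :=
  {t | 2 * N ≤ (t : ℕ)}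

/-- Whether a packet of user `j` is recycled, in terms of the feedback states `F` and the feedback
values `Fv` of the slot in which it was sent: either the other receiver has reported its reception,
or receiver `j` has reported an erasure while the report of the other receiver was lost. -/
def reusable (j : User) (F Fv : User → Bool) : Bool :=
  Fv (other j) || (F j && !F (other j) && !Fv j)

/-- The link states under which a packet of user `j` is recycled. -/
def reusableState (j : User) : Set State :=
  {x | reusable j x.2.1 (fun i => x.2.1 i && x.1 i) = true}

/-- The packet of user `j` sent in slot `s`, for the message vector `x`, if it is recycled according
to the flags `V`, and `0` if it is not. -/
def cached {ι : Type*} [Fintype ι] {n : ℕ} (N : ℕ) (j : User) (G : User × Fin n → ι → ZMod 2)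
    (x : ι → ZMod 2) (V : Fin n → Bool) (s : Fin n) : ZMod 2 :=
  if s ∈ ownSlots n N j ∧ V s = true then G (j, s) ⬝ᵥ x else 0

section Code

variable {ι : Type*} [Fintype ι] {n : ℕ} {M : User → ℕ} (N : ℕ)
  (emb : (j : User) → Fin (M j) → ι → ZMod 2)
  (G : User × Fin n → ι → ZMod 2) (P : Fin n → User × Fin n → ZMod 2)

/-- The message `m` agrees with everything that receiver `i` has observed, for some value `c` of the
recycled packets of the other user. Only these packets, and not the message of the other user, are
searched over: they take far fewer values. -/
def Consistent (i : User) (y : Fin n → ZMod 2) (csi : Fin n → Bool) (V : User → Fin n → Bool)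
    (m : Fin (M i)) : Prop :=
  (∀ s ∈ ownSlots n N i, csi s = true → G (i, s) ⬝ᵥ emb i m = y s) ∧
    ∃ c : Fin n → ZMod 2,
      (∀ s, ¬ (s ∈ ownSlots n N (other i) ∧ V (other i) s = true) → c s = 0) ∧
      (∀ s ∈ ownSlots n N (other i), V (other i) s = true → csi s = true → c s = y s) ∧
      ∀ t ∈ mixedSlots n N, csi t = true →
        (P t ⬝ᵥ fun p => if p.1 = i then cached N i G (emb i m) (V i) p.2 else c p.2) = y t

open Classical in
/-- The code with coefficients `G` and `P`. In the slots of user `j` the transmitter sends the linear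
combination of the bits of message `j` given by `G`, and in the mixed slots the linear combination of
the recycled packets given by `P`. Receiver `i` picks a consistent message; it knows which packets
are recycled because it sees all the reports that reach the transmitter. -/
def linearCode (hM : ∀ j, 0 < M j) : Code n M where
  encode t w F Fv :=
    if 2 * N ≤ (t : ℕ) then
      P t ⬝ᵥ fun p => if h : p.2 < t then
        cached N p.1 G (emb p.1 (w p.1)) (fun _ => reusable p.1 (F ⟨p.2, h⟩) (Fv ⟨p.2, h⟩)) p.2 else 0
    else ∑ j, if t ∈ ownSlots n N j then G (j, t) ⬝ᵥ emb j (w j) else 0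
  decode i y csi fb fv :=
    let F : Fin n → User → Bool := fun s j => if j = i then (fb s).1 else (fb s).2
    let Fv : Fin n → User → Bool := fun s j => if j = i then (fb s).1 && csi s else fv s
    let V : User → Fin n → Bool := fun j s => reusable j (F s) (Fv s)
    if h : ∃ m, Consistent N emb G P i y csi V m then h.choose else ⟨0, hM i⟩

variable {N emb G P}

theorem input_of_mem_ownSlots (hM : ∀ j, 0 < M j) (w : (j : User) → Fin (M j))
    (σ : Fin n → State) {j : User} {s : Fin n} (hs : s ∈ ownSlots n N j) :
    (linearCode N emb G P hM).input w σ s = G (j, s) ⬝ᵥ emb j (w j) := by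
  have h2 : ¬ 2 * N ≤ (s : ℕ) := by
    simp only [ownSlots, Finset.mem_filter, Finset.mem_univ, true_and] at hs
    have : ((j : ℕ) + 1) * N ≤ 2 * N := Nat.mul_le_mul_right _ (by omega)
    omega
  have h3 : ∀ k, s ∈ ownSlots n N k ↔ k = j := by
    intro k
    refine ⟨fun hk => ?_, fun h => h ▸ hs⟩
    simp only [ownSlots, Finset.mem_filter, Finset.mem_univ, true_and] at hs hk
    rw [Fin.ext_iff]
    have h4 : (k : ℕ) < j + 1 := Nat.lt_of_mul_lt_mul_right (hk.1.trans_lt hs.2)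
    have h5 : (j : ℕ) < k + 1 := Nat.lt_of_mul_lt_mul_right (hs.1.trans_lt hk.2)
    omega
  simp only [Code.input, linearCode, if_neg h2, h3]
  rw [Finset.sum_ite_eq' Finset.univ j]
  simp

open Classical in
theorem input_of_mem_mixedSlots (hM : ∀ j, 0 < M j) (w : (j : User) → Fin (M j))
    (σ : Fin n → State) {t : Fin n} (ht : t ∈ mixedSlots n N) :
    (linearCode N emb G P hM).input w σ t = P t ⬝ᵥ fun p =>
      cached N p.1 G (emb p.1 (w p.1)) (fun s => decide (σ s ∈ reusableState p.1)) p.2 := by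
  have h2 : 2 * N ≤ (t : ℕ) := by simpa [mixedSlots] using ht
  simp only [Code.input, linearCode, if_pos h2]
  congr 1
  funext p
  by_cases hp : p.2 < t
  · rw [dif_pos hp]
    simp only [cached, decide_eq_true_iff]
    exact if_congr Iff.rfl rfl rfl
  · rw [dif_neg hp, cached, if_neg]
    rintro ⟨hs, -⟩
    simp only [ownSlots, Finset.mem_filter, Finset.mem_univ, true_and] at hs
    have : ((p.1 : ℕ) + 1) * N ≤ 2 * N := Nat.mul_le_mul_right _ (by omega)
    exact hp (Fin.lt_def.2 (by omega))

open Finset Classical in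
/-- A decoding error at receiver `i` comes from a wrong message that is consistent with its
observations; subtracting the true message, which is consistent too, yields a collision. -/
theorem exists_collision_of_estimate_ne (hM : ∀ j, 0 < M j) {w : (j : User) → Fin (M j)}
    {σ : Fin n → State} {i : User} (hσ : ∀ t j, (σ t).2.1 j = (σ t).2.2 j)
    (hne : (linearCode N emb G P hM).estimate w σ i ≠ w i) :
    ∃ m ≠ w i, Collision i (hits (ownSlots n N i) {x | x.1 i = true} σ)
      (hits (ownSlots n N i) (reusableState i) σ)
      (hits (ownSlots n N (other i)) (reusableState (other i) ∩ {x | x.1 i = false}) σ)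
      (hits (mixedSlots n N) {x | x.1 i = true} σ)
      (emb i m - emb i (w i)) G P := by
  set c := linearCode N emb G P hM
  have hio : ∀ j, j ≠ i → j = other i := by
    exact (by decide : ∀ i j : User, j ≠ i → j = other i) i
  -- The recycling flags computed at the receiver are those of the transmitter.
  have hV : (fun (j : User) (s : Fin n) => reusable j
      (fun j => if j = i then (σ s).2.1 i else (σ s).2.2 (other i))
      (fun j => if j = i then (σ s).2.1 i && (σ s).1 i else (σ s).2.2 (other i) && (σ s).1 (other i)))
      = fun j s => decide (σ s ∈ reusableState j) := by
    funext j s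
    have h1 : (fun j => if j = i then (σ s).2.1 i else (σ s).2.2 (other i)) = (σ s).2.1 := by
      funext k
      split_ifs with hk
      · rw [hk]
      · rw [hio k hk, hσ]
    have h2 : (fun j => if j = i then (σ s).2.1 i && (σ s).1 i
        else (σ s).2.2 (other i) && (σ s).1 (other i)) = fun j => (σ s).2.1 j && (σ s).1 j := by
      funext k
      split_ifs with hk
      · rw [hk]
      · rw [hio k hk, hσ]
    rw [h1, h2]
    rw [Bool.eq_iff_iff, decide_eq_true_iff]
    exact Iff.rfl
  have hy : ∀ t, (σ t).1 i = true → c.output w σ i t = c.input w σ t := fun t h => by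
    simp [Code.output, h]
  set V : User → Fin n → Bool := fun j s => decide (σ s ∈ reusableState j)
  have hmix : ∀ t ∈ mixedSlots n N, (σ t).1 i = true → (P t ⬝ᵥ fun p => if p.1 = i then
      cached N i G (emb i (w i)) (V i) p.2 else
      cached N (other i) G (emb _ (w (other i))) (V (other i)) p.2) = c.output w σ i t := by
    intro t ht h
    rw [hy t h, input_of_mem_mixedSlots hM w σ ht]
    congr 1
    funext p
    split_ifs with hp
    · rw [hp]
    · rw [hio _ hp]
  -- The true message is consistent, with the true packets of the other user.
  have htrue : Consistent N emb G P i (c.output w σ i) (fun t => (σ t).1 i) V (w i) := by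
    refine ⟨fun s hs h => ?_, cached N (other i) G (emb _ (w (other i))) (V (other i)),
      fun s hs => if_neg hs, fun s hs hs' h => ?_, hmix⟩
    · rw [hy s h, input_of_mem_ownSlots hM w σ hs]
    · rw [hy s h, input_of_mem_ownSlots hM w σ hs, cached, if_pos ⟨hs, hs'⟩]
  have hex : ∃ m, Consistent N emb G P i (c.output w σ i) (fun t => (σ t).1 i) V m := ⟨_, htrue⟩
  have hest : Consistent N emb G P i (c.output w σ i) (fun t => (σ t).1 i) V (c.estimate w σ i) := by
    have : c.estimate w σ i = hex.choose := by
      have hdif : ∀ V', V' = V →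
          (if h : ∃ m, Consistent N emb G P i (c.output w σ i) (fun t => (σ t).1 i) V' m
            then h.choose else ⟨0, hM i⟩) = hex.choose := by
        rintro _ rfl
        exact dif_pos hex
      exact hdif _ hV
    rw [this]
    exact hex.choose_spec
  refine ⟨_, hne, ?_⟩
  obtain ⟨h1, e, he1, he2, he3⟩ := hest
  refine ⟨?_, fun s => e s - cached N (other i) G (emb _ (w (other i))) (V (other i)) s, ?_, ?_⟩
  · intro s hs
    simp only [mem_hits, Set.mem_ofPred_eq] at hs
    rw [dotProduct_sub, h1 s hs.1 hs.2, htrue.1 s hs.1 hs.2, sub_self]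
  · intro s hs
    change e s - cached N (other i) G (emb _ (w (other i))) (V (other i)) s = 0
    simp only [mem_hits, Set.mem_inter_iff, Set.mem_ofPred_eq, not_and, Bool.not_eq_false] at hs
    by_cases h : s ∈ ownSlots n N (other i) ∧ V (other i) s = true
    · have hs' := hs h.1 (by simpa [V] using h.2)
      rw [he2 s h.1 h.2 hs', hy s hs', input_of_mem_ownSlots hM w σ h.1, cached, if_pos h, sub_self]
    · rw [he1 s h, cached, if_neg h, sub_self]
  · intro t ht
    simp only [mem_hits, Set.mem_ofPred_eq] at ht
    have := (he3 t ht.1 ht.2).trans (hmix t ht.1 ht.2).symm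
    rw [← sub_eq_zero, ← dotProduct_sub] at this
    rw [← this]
    congr 1
    funext p
    by_cases hp : p.1 = i
    · simp only [mixedVector, hp, if_true, Pi.sub_apply, cached, V, mem_hits, decide_eq_true_eq,
        dotProduct_sub]
      split_ifs <;> simp
    · simp [mixedVector, hp]

end Code

/-! ### Averaging over the linear codes -/

open Finset in
/-- The link states `σ` let receiver `i` decode `K` message bits with a margin of `L` equations:
the packets that it has heard or that are recycled determine its message, and what it hears in its
own and in the mixed slots outnumbers the message bits together with the unknown recycled packets of
the other user. -/
structure Typical {n : ℕ} (N K L : ℕ) (i : User) (σ : Fin n → State) : Prop where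
  corr : ∀ t j, (σ t).2.1 j = (σ t).2.2 j
  own : K + L ≤ #(hits (ownSlots n N i) ({x | x.1 i = true} ∪ reusableState i) σ)
  total : K + L + #(hits (ownSlots n N (other i)) (reusableState (other i) ∩ {x | x.1 i = false}) σ) ≤
    #(hits (ownSlots n N i) {x | x.1 i = true} σ) +
      #(hits (mixedSlots n N) {x | x.1 i = true} σ)

open Finset Classical in
/-- For typical link states, a union bound over the wrong messages shows that receiver `i` errs for a
fraction of at most `2 * 2 ^ (-L)` of the linear codes. -/
theorem card_estimate_ne_le {n N K L : ℕ} {M : User → ℕ} (hM : ∀ j, 0 < M j)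
    (hMK : ∀ j, M j ≤ 2 ^ K) (emb : (j : User) → Fin (M j) ↪ (Fin K → ZMod 2)) {i : User}
    {σ : Fin n → State} (hσ : Typical N K L i σ) (w : (j : User) → Fin (M j)) :
    (#{ω : (User × Fin n → Fin K → ZMod 2) × (Fin n → User × Fin n → ZMod 2) |
      (linearCode N (fun j => emb j) ω.1 ω.2 hM).estimate w σ i ≠ w i} : ℝ) ≤
      2 * (1 / 2) ^ L *
        Fintype.card ((User × Fin n → Fin K → ZMod 2) × (Fin n → User × Fin n → ZMod 2)) := by
  set Ω := (User × Fin n → Fin K → ZMod 2) × (Fin n → User × Fin n → ZMod 2)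
  set H := hits (ownSlots n N i) {x | x.1 i = true} σ with hH
  set V := hits (ownSlots n N i) (reusableState i) σ with hV
  set U := hits (ownSlots n N (other i)) (reusableState (other i) ∩ {x | x.1 i = false}) σ
  set T := hits (mixedSlots n N) {x | x.1 i = true} σ
  have hHV : K + L ≤ #(H ∪ V) := by
    rw [hH, hV, ← hits_union]
    exact hσ.own
  have htot : K + L + #U ≤ #H + #T := hσ.total
  have hsub : ({ω : Ω | (linearCode N (fun j => emb j) ω.1 ω.2 hM).estimate w σ i ≠ w i} :
      Finset Ω) ⊆ (univ.erase (w i)).biUnion fun m =>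
        {ω : Ω | Collision i H V U T (emb i m - emb i (w i)) ω.1 ω.2} := by
    intro ω hω
    simp only [mem_filter, mem_univ, true_and] at hω
    obtain ⟨m, hm, hc⟩ := exists_collision_of_estimate_ne hM hσ.corr hω
    simp only [mem_biUnion, mem_erase, mem_univ, and_true, mem_filter, true_and]
    exact ⟨m, hm, hc⟩
  have hp : (1 / 2 : ℝ) ^ #(H ∪ V) + (1 / 2) ^ #H * (2 ^ #U * (1 / 2) ^ #T) ≤
      2 * (1 / 2) ^ (K + L) := by
    have h1 : (1 / 2 : ℝ) ^ #(H ∪ V) ≤ (1 / 2) ^ (K + L) :=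
      pow_le_pow_of_le_one (by norm_num) (by norm_num) hHV
    have h2 : (1 / 2 : ℝ) ^ #H * (2 ^ #U * (1 / 2) ^ #T) ≤ (1 / 2) ^ (K + L) := by
      calc (1 / 2 : ℝ) ^ #H * (2 ^ #U * (1 / 2) ^ #T) = 2 ^ #U * (1 / 2) ^ (#H + #T) := by
            rw [pow_add]; ring
        _ ≤ 2 ^ #U * (1 / 2) ^ (K + L + #U) := by
            gcongr ?_ * ?_
            exact pow_le_pow_of_le_one (by norm_num) (by norm_num) htot
        _ = (1 / 2) ^ (K + L) * (2 * (1 / 2)) ^ #U := by rw [pow_add _ (K + L), mul_pow]; ring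
        _ = _ := by norm_num
    linarith
  calc (#{ω : Ω | (linearCode N (fun j => emb j) ω.1 ω.2 hM).estimate w σ i ≠ w i} : ℝ)
      ≤ ∑ m ∈ univ.erase (w i),
          (#{ω : Ω | Collision i H V U T (emb i m - emb i (w i)) ω.1 ω.2} : ℝ) := by
        exact_mod_cast (card_le_card hsub).trans card_biUnion_le
    _ ≤ ∑ m ∈ univ.erase (w i), 2 * (1 / 2) ^ (K + L) * (Fintype.card Ω : ℝ) := by
        refine sum_le_sum fun m hm => ?_
        refine (card_collision_le i H V U T (sub_ne_zero.2 fun h =>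
          (mem_erase.1 hm).1 ((emb i).injective h))).trans ?_
        gcongr
    _ ≤ 2 ^ K * (2 * (1 / 2) ^ (K + L) * (Fintype.card Ω : ℝ)) := by
        rw [sum_const, nsmul_eq_mul]
        gcongr
        exact_mod_cast ((card_le_univ _).trans (by simp)).trans (hMK i)
    _ = (2 * (1 / 2)) ^ K * (2 * (1 / 2) ^ L * (Fintype.card Ω : ℝ)) := by
        rw [mul_pow, pow_add]; ring
    _ = _ := by rw [show (2 : ℝ) * (1 / 2) = 1 by norm_num, one_pow, one_mul]

instance (C : Channel) : IsProbabilityMeasure C.stateLaw := by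
  unfold Channel.stateLaw; infer_instance

instance (C : Channel) (n : ℕ) : IsProbabilityMeasure (C.blockLaw n) := by
  unfold Channel.blockLaw; infer_instance

open Finset Classical in
/-- The random coding argument: on average over the linear codes each error probability is at most
`q + 2 * 2 ^ (-L)`, so some code has a sum of error probabilities of at most twice that bound. -/
theorem exists_code_errorProb_le (C : Channel) {n N K L : ℕ} {M : User → ℕ} (hM : ∀ j, 0 < M j)
    (hMK : ∀ j, M j ≤ 2 ^ K) {q : ℝ}
    (hq : ∀ i, (C.blockLaw n).real {σ | ¬ Typical N K L i σ} ≤ q) :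
    ∃ c : Code n M, ∀ i, c.errorProb C i ≤ 2 * (q + 2 * (1 / 2) ^ L) := by
  set Ω := (User × Fin n → Fin K → ZMod 2) × (Fin n → User × Fin n → ZMod 2)
  have hemb : ∀ j, Nonempty (Fin (M j) ↪ (Fin K → ZMod 2)) := fun j =>
    Function.Embedding.nonempty_of_card_le (by simpa [ZMod.card] using hMK j)
  let emb := fun j => (hemb j).some
  let code : Ω → Code n M := fun ω => linearCode N (fun j => emb j) ω.1 ω.2 hM
  set ν := C.blockLaw n
  set B : ℝ := q + 2 * (1 / 2) ^ L
  have hw : ∀ i w, ∑ ω : Ω, ν.real {σ | (code ω).estimate w σ i ≠ w i} ≤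
      ∑ ω : Ω, B := by
    intro i w
    have h1 : ∀ ω : Ω, ν.real {σ | (code ω).estimate w σ i ≠ w i} ≤ q +
        ∑ σ with Typical N K L i σ, ν.real {σ} *
          if (code ω).estimate w σ i ≠ w i then 1 else 0 := by
      intro ω
      calc ν.real {σ | (code ω).estimate w σ i ≠ w i}
          ≤ ν.real ({σ | ¬ Typical N K L i σ} ∪ (({σ | Typical N K L i σ ∧
              (code ω).estimate w σ i ≠ w i} : Finset _) : Set (Fin n → State))) := by
            refine measureReal_mono fun σ hσ => ?_
            by_cases h : Typical N K L i σ
            · right; simpa [h] using hσ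
            · left; exact h
        _ ≤ _ := measureReal_union_le _ _
        _ ≤ _ := by
            refine add_le_add (hq i) (le_of_eq ?_)
            rw [← sum_measureReal_singleton, ← filter_filter]
            simp only [mul_ite, mul_one, mul_zero, ← sum_filter]
    calc ∑ ω : Ω, ν.real {σ | (code ω).estimate w σ i ≠ w i}
        ≤ ∑ ω : Ω, (q + ∑ σ with Typical N K L i σ, ν.real {σ} *
          if (code ω).estimate w σ i ≠ w i then 1 else 0) := sum_le_sum fun ω _ => h1 ω
      _ = Fintype.card Ω * q + ∑ σ with Typical N K L i σ, ν.real {σ} *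
          #{ω : Ω | (code ω).estimate w σ i ≠ w i} := by
          rw [sum_add_distrib, sum_const, nsmul_eq_mul, card_univ, sum_comm]
          simp only [← mul_sum, sum_boole]
      _ ≤ Fintype.card Ω * q + ∑ σ with Typical N K L i σ, ν.real {σ} *
          (2 * (1 / 2) ^ L * Fintype.card Ω) := by
          gcongr with σ hσ
          exact card_estimate_ne_le hM hMK emb (mem_filter.1 hσ).2 w
      _ ≤ Fintype.card Ω * q + 1 * (2 * (1 / 2) ^ L * Fintype.card Ω) := by
          rw [← sum_mul, sum_measureReal_singleton]
          gcongr
          exact measureReal_le_one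
      _ = ∑ ω : Ω, B := by
          rw [sum_const, nsmul_eq_mul, card_univ]; ring
  have hprod : (0 : ℝ) < ∏ j, (M j : ℝ) := prod_pos fun j _ => by exact_mod_cast hM j
  have herr : ∀ i, ∑ ω : Ω, (code ω).errorProb C i ≤ ∑ ω : Ω, B := by
    intro i
    simp only [Code.errorProb, ← sum_div]
    rw [div_le_iff₀ hprod, sum_comm]
    calc _ ≤ ∑ w : (j : User) → Fin (M j), ∑ ω : Ω, B := sum_le_sum fun w _ => hw i w
      _ = _ := by
        rw [sum_const, nsmul_eq_mul, card_univ, Fintype.card_pi]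
        simp [mul_comm]
  obtain ⟨ω, -, hω⟩ := exists_le_of_sum_le (s := (univ : Finset Ω)) univ_nonempty
    (f := fun ω => ∑ i, (code ω).errorProb C i) (g := fun _ => 2 * B) (by
      rw [sum_comm]
      calc _ ≤ ∑ i : User, ∑ ω : Ω, B := sum_le_sum fun i _ => herr i
        _ = _ := by simp; ring)
  refine ⟨code ω, fun i => le_trans ?_ hω⟩
  exact single_le_sum (f := fun i => (code ω).errorProb C i)
    (fun j _ => div_nonneg (sum_nonneg fun _ _ => measureReal_nonneg) hprod.le) (mem_univ i)

/-! ### The law of the link states in one slot -/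

namespace Channel

variable (C : Channel)

theorem stateLaw_real_prod (A : Set ForwardState) (B : Set FeedbackState) :
    C.stateLaw.real (A ×ˢ B) = C.forwardLaw.toMeasure.real A * C.feedbackLaw.toMeasure.real B :=
  measureReal_prod_prod A B

theorem ae_blockLaw (hcorr : ∀ᵐ f ∂C.feedbackLaw.toMeasure, ∀ i, f.1 i = f.2 i) (n : ℕ) :
    ∀ᵐ σ ∂C.blockLaw n, ∀ t j, (σ t).2.1 j = (σ t).2.2 j := by
  rw [ae_all_iff]
  intro t
  have h1 : ∀ᵐ x ∂C.stateLaw, ∀ i, x.2.1 i = x.2.2 i :=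
    (Measure.quasiMeasurePreserving_snd (μ := C.forwardLaw.toMeasure)
      (ν := C.feedbackLaw.toMeasure)).ae hcorr
  exact (measurePreserving_eval (fun _ : Fin n => C.stateLaw) t).quasiMeasurePreserving.ae h1

variable {C} {δ : ℝ}

theorem forward_real_off (hδ : ∀ i, C.erasure i = δ) (i : User) :
    C.forwardLaw.toMeasure.real {s | s i = false} = δ := hδ i

theorem forward_real_on (hδ : ∀ i, C.erasure i = δ) (i : User) :
    C.forwardLaw.toMeasure.real {s | s i = true} = 1 - δ := by
  rw [← hδ i, erasure, ← probReal_compl_eq_one_sub .of_discrete]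
  congr 1
  ext s
  simp

theorem forward_real_both_off (hδ12 : C.jointErasure = δ ^ 2) (i : User) :
    C.forwardLaw.toMeasure.real {s | s i = false ∧ s (other i) = false} = δ ^ 2 := by
  rw [← hδ12, jointErasure]
  congr 1
  ext s
  fin_cases i <;> simp [other, and_comm]

theorem feedback_real_off (hcorr : ∀ᵐ f ∂C.feedbackLaw.toMeasure, ∀ i, f.1 i = f.2 i)
    (hδF : ∀ i, C.feedbackErasure i = δ) (i : User) :
    C.feedbackLaw.toMeasure.real {f | f.1 i = false} = δ := by
  rw [← hδF i, feedbackErasure]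
  refine measureReal_congr ?_
  filter_upwards [hcorr] with f hf
  change (f.1 i = false) = ((f.1 i && f.2 i) = false)
  rw [← hf i, Bool.and_self]

theorem feedback_real_both_off (hδFF : C.jointFeedbackErasure = δ ^ 2) (i : User) :
    C.feedbackLaw.toMeasure.real {f | f.1 i = false ∧ f.1 (other i) = false} = δ ^ 2 := by
  rw [← hδFF, jointFeedbackErasure]
  congr 1
  ext s
  fin_cases i <;> simp [other, and_comm]

theorem stateLaw_real_heard (hδ : ∀ i, C.erasure i = δ) (i : User) :
    C.stateLaw.real {x | x.1 i = true} = 1 - δ := by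
  have : {x : State | x.1 i = true} = {s | s i = true} ×ˢ Set.univ := by ext; simp
  rw [this, stateLaw_real_prod, forward_real_on hδ, probReal_univ, mul_one]

/-- A packet of user `i` that receiver `i` has missed is not recycled in two cases: the other report
arrives and says that the other receiver has missed it too, which has probability
`δ ^ 2 * (1 - δ)`, or no report arrives, which has probability `δ * δ ^ 2`. -/
theorem stateLaw_real_heard_or_reusable
    (hcorr : ∀ᵐ f ∂C.feedbackLaw.toMeasure, ∀ i, f.1 i = f.2 i)
    (hδ : ∀ i, C.erasure i = δ) (hδF : ∀ i, C.feedbackErasure i = δ)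
    (hδFF : C.jointFeedbackErasure = δ ^ 2) (hδ12 : C.jointErasure = δ ^ 2) (i : User) :
    C.stateLaw.real ({x | x.1 i = true} ∪ reusableState i) = 1 - δ ^ 2 := by
  have hset : ({x | x.1 i = true} ∪ reusableState i)ᶜ =
      ({s | s i = false ∧ s (other i) = false} ×ˢ {f | f.1 (other i) = false}ᶜ) ∪
        ({s | s i = false} ×ˢ {f | f.1 i = false ∧ f.1 (other i) = false}) := by
    ext ⟨s, f⟩
    simp only [reusableState, reusable, Set.mem_compl_iff, Set.mem_union, Set.mem_ofPred_eq,
      Set.mem_prod]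
    cases s i <;> cases s (other i) <;> cases f.1 i <;> cases f.1 (other i) <;> decide
  have hdisj : Disjoint
      ({s | s i = false ∧ s (other i) = false} ×ˢ {f : FeedbackState | f.1 (other i) = false}ᶜ)
      ({s : ForwardState | s i = false} ×ˢ {f | f.1 i = false ∧ f.1 (other i) = false}) :=
    Set.disjoint_left.2 fun x h1 h2 => h1.2 h2.2.2
  have h := probReal_compl_eq_one_sub (μ := C.stateLaw)
    (s := {x | x.1 i = true} ∪ reusableState i) .of_discrete
  rw [hset, measureReal_union hdisj .of_discrete, stateLaw_real_prod, stateLaw_real_prod,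
    probReal_compl_eq_one_sub .of_discrete, forward_real_both_off hδ12,
    feedback_real_off hcorr hδF, forward_real_off hδ, feedback_real_both_off hδFF] at h
  linarith

/-- A packet of the other user that receiver `i` has missed is recycled only if the other receiver
has reported an erasure and the report of receiver `i` was lost. -/
theorem stateLaw_real_reusable_and_missed
    (hcorr : ∀ᵐ f ∂C.feedbackLaw.toMeasure, ∀ i, f.1 i = f.2 i)
    (hδF : ∀ i, C.feedbackErasure i = δ)
    (hδFF : C.jointFeedbackErasure = δ ^ 2) (hδ12 : C.jointErasure = δ ^ 2) (i : User) :
    C.stateLaw.real (reusableState (other i) ∩ {x | x.1 i = false}) = δ ^ 3 * (1 - δ) := by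
  have hoo : other (other i) = i := by fin_cases i <;> rfl
  have hset : reusableState (other i) ∩ {x | x.1 i = false} =
      {s | s i = false ∧ s (other i) = false} ×ˢ
        ({f | f.1 i = false} \ {f | f.1 i = false ∧ f.1 (other i) = false}) := by
    ext ⟨s, f⟩
    simp only [reusableState, reusable, hoo, Set.mem_inter_iff, Set.mem_ofPred_eq,
      Set.mem_prod, Set.mem_sdiff]
    cases s i <;> cases s (other i) <;> cases f.1 i <;> cases f.1 (other i) <;> decide
  rw [hset, stateLaw_real_prod, forward_real_both_off hδ12,
    measureReal_sdiff (fun f hf => hf.1) .of_discrete, feedback_real_off hcorr hδF,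
    feedback_real_both_off hδFF]
  ring

end Channel

/-! ### Typicality and the achievable rate -/

theorem card_filter_val_mem_Ico {n a b : ℕ} (h : b ≤ n) :
    (Finset.univ.filter fun t : Fin n => a ≤ (t : ℕ) ∧ (t : ℕ) < b).card = b - a := by
  rw [← Nat.card_Ico, ← Finset.card_map Fin.valEmbedding]
  congr 1
  ext x
  simp only [Finset.mem_map, Finset.mem_filter, Finset.mem_univ, true_and, Fin.valEmbedding_apply,
    Finset.mem_Ico]
  exact ⟨by rintro ⟨t, ht, rfl⟩; exact ht, fun hx => ⟨⟨x, by omega⟩, hx, rfl⟩⟩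

theorem card_ownSlots {n N : ℕ} (h : 2 * N ≤ n) (j : User) : (ownSlots n N j).card = N := by
  have h2 : ((j : ℕ) + 1) * N ≤ 2 * N := Nat.mul_le_mul_right _ (by omega)
  rw [ownSlots, card_filter_val_mem_Ico (h2.trans h), Nat.succ_mul, Nat.add_sub_cancel_left]

theorem card_mixedSlots (n N : ℕ) : (mixedSlots n N).card = n - 2 * N := by
  rw [← card_filter_val_mem_Ico (le_refl n), mixedSlots]
  congr 1
  ext t
  simp

open Finset in
theorem measureReal_not_typical_le {C : Channel} {δ : ℝ}
    (hcorr : ∀ᵐ f ∂C.feedbackLaw.toMeasure, ∀ i, f.1 i = f.2 i)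
    (hδ : ∀ i, C.erasure i = δ) (hδF : ∀ i, C.feedbackErasure i = δ)
    (hδFF : C.jointFeedbackErasure = δ ^ 2) (hδ12 : C.jointErasure = δ ^ 2)
    {n N K L : ℕ} (hn : 0 < n) (hN : 2 * N ≤ n) {ε : ℝ} (hε : 0 < ε)
    (hown : (K + L : ℝ) ≤ (1 - δ ^ 2) * N - ε * n)
    (htotal : (K + L : ℝ) + δ ^ 3 * (1 - δ) * N ≤
      (1 - δ) * N + (1 - δ) * (n - 2 * N) - 3 * (ε * n)) (i : User) :
    (C.blockLaw n).real {σ | ¬ Typical N K L i σ} ≤ 4 * (1 / (ε ^ 2 * n)) := by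
  set dev : Set State → Finset (Fin n) → Set (Fin n → State) := fun B I =>
    {σ | ε * n ≤ |(#(hits I B σ) : ℝ) - C.stateLaw.real B * #I|}
  have hd : ∀ B I, (C.blockLaw n).real (dev B I) ≤ 1 / (ε ^ 2 * n) := fun B I =>
    measureReal_abs_count_sub_ge_le C.stateLaw hn B I hε
  set D1 := dev ({x | x.1 i = true} ∪ reusableState i) (ownSlots n N i)
  set D2 := dev (reusableState (other i) ∩ {x | x.1 i = false}) (ownSlots n N (other i))
  set D3 := dev {x | x.1 i = true} (ownSlots n N i)
  set D4 := dev {x | x.1 i = true} (mixedSlots n N)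
  set Z : Set (Fin n → State) := {σ | ¬ ∀ t j, (σ t).2.1 j = (σ t).2.2 j}
  have hZ : (C.blockLaw n).real Z = 0 := by
    rw [measureReal_eq_zero_iff]
    exact C.ae_blockLaw hcorr n
  have hsub : {σ | ¬ Typical N K L i σ} ⊆ Z ∪ (D1 ∪ (D2 ∪ (D3 ∪ D4))) := by
    intro σ hσ
    by_contra hcon
    simp only [Set.mem_union, not_or] at hcon
    obtain ⟨hz, h1, h2, h3, h4⟩ := hcon
    refine hσ ?_
    have hb : ∀ {B I}, σ ∉ dev B I →
        |(#(hits I B σ) : ℝ) - C.stateLaw.real B * #I| < ε * n := fun h => not_le.1 h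
    have h1 := abs_lt.1 (hb h1)
    have h2 := abs_lt.1 (hb h2)
    have h3 := abs_lt.1 (hb h3)
    have h4 := abs_lt.1 (hb h4)
    rw [Channel.stateLaw_real_heard_or_reusable hcorr hδ hδF hδFF hδ12, card_ownSlots hN] at h1
    rw [Channel.stateLaw_real_reusable_and_missed hcorr hδF hδFF hδ12, card_ownSlots hN] at h2
    rw [Channel.stateLaw_real_heard hδ, card_ownSlots hN] at h3
    rw [Channel.stateLaw_real_heard hδ, card_mixedSlots, Nat.cast_sub hN] at h4
    push_cast at h4
    refine ⟨not_not.1 hz, ?_, ?_⟩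
    · rw [← Nat.cast_le (α := ℝ)]
      push_cast
      exact hown.trans (by linarith [h1.1])
    · rw [← Nat.cast_le (α := ℝ)]
      push_cast
      linarith [h2.2, h3.1, h4.1]
  calc (C.blockLaw n).real {σ | ¬ Typical N K L i σ}
      ≤ (C.blockLaw n).real (Z ∪ (D1 ∪ (D2 ∪ (D3 ∪ D4)))) := measureReal_mono hsub
    _ ≤ (C.blockLaw n).real Z + ((C.blockLaw n).real D1 + ((C.blockLaw n).real D2 +
          ((C.blockLaw n).real D3 + (C.blockLaw n).real D4))) :=
        (measureReal_union_le _ _).trans (add_le_add_right ((measureReal_union_le _ _).trans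
          (add_le_add_right ((measureReal_union_le _ _).trans
            (add_le_add_right (measureReal_union_le _ _) _)) _)) _)
    _ ≤ _ := by
        linarith [hd ({x | x.1 i = true} ∪ reusableState i) (ownSlots n N i),
          hd (reusableState (other i) ∩ {x | x.1 i = false}) (ownSlots n N (other i)),
          hd {x | x.1 i = true} (ownSlots n N i), hd {x | x.1 i = true} (mixedSlots n N)]

/-- All symmetric rates below the claimed one are achievable. -/
theorem achievable_of_lt {C : Channel} {δ : ℝ}
    (hcorr : ∀ᵐ f ∂C.feedbackLaw.toMeasure, ∀ i, f.1 i = f.2 i)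
    (hδ : ∀ i, C.erasure i = δ) (hδF : ∀ i, C.feedbackErasure i = δ)
    (hδFF : C.jointFeedbackErasure = δ ^ 2) (hδ12 : C.jointErasure = δ ^ 2) {R : ℝ} (hR : 0 ≤ R)
    (hlt : R < (1 - δ ^ 2) / (2 + δ + δ ^ 3)) : C.Achievable (R, R) := by
  have hδ0 : 0 ≤ δ := hδ 0 ▸ measureReal_nonneg
  have hδ1 : δ ≤ 1 := hδ 0 ▸ measureReal_le_one
  have hs : 0 < 2 + δ + δ ^ 3 := by positivity
  set ν : ℝ := 1 / (2 + δ + δ ^ 3) with hν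
  have hνs : ν * (2 + δ + δ ^ 3) = 1 := by rw [hν]; field_simp
  have hν0 : 0 < ν := by positivity
  set η : ℝ := (1 - δ ^ 2) / (2 + δ + δ ^ 3) - R with hη
  have hη0 : 0 < η := sub_pos.2 hlt
  have hRη : R = (1 - δ ^ 2) * ν - η := by rw [hη, hν]; ring
  -- Each user gets a fraction `ν` of the slots to itself; the mixed slots take the remaining fraction
  -- `ν * (δ + δ ^ 3)`.
  set N : ℕ → ℕ := fun n => ⌊ν * n⌋₊
  set K : ℕ → ℕ := fun n => ⌈(n : ℝ) * R⌉₊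
  -- Both margins are `η * n`, less at most `3 * (η / 4) * n` for the deviations and a constant for
  -- the roundings.
  set L : ℕ → ℕ := fun n => ⌊η / 4 * n - 3⌋₊
  set M : ℕ → User → ℕ := fun n =>
    ![⌈(2 : ℝ) ^ ((n : ℝ) * R)⌉₊, ⌈(2 : ℝ) ^ ((n : ℝ) * R)⌉₊]
  have hM : ∀ n j, 0 < M n j := by
    intro n j
    have : 0 < ⌈(2 : ℝ) ^ ((n : ℝ) * R)⌉₊ := Nat.ceil_pos.2 (by positivity)
    fin_cases j <;> exact this
  have hMK : ∀ n j, M n j ≤ 2 ^ K n := by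
    intro n j
    have : ⌈(2 : ℝ) ^ ((n : ℝ) * R)⌉₊ ≤ 2 ^ K n := by
      rw [Nat.ceil_le]
      push_cast
      rw [← Real.rpow_natCast]
      exact Real.rpow_le_rpow_of_exponent_le (by norm_num) (Nat.le_ceil _)
    fin_cases j <;> exact this
  have hcode : ∀ n, ∃ c : Code n (M n), 0 < n → 3 ≤ η / 4 * n → ∀ i, c.errorProb C i ≤
      2 * (4 * (1 / ((η / 4) ^ 2 * n)) + 2 * (1 / 2) ^ L n) := by
    intro n
    by_cases hn : 0 < n ∧ 3 ≤ η / 4 * n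
    swap
    · exact ⟨⟨fun _ _ _ _ => 0, fun i _ _ _ _ => ⟨0, hM n i⟩⟩, fun h h' => absurd ⟨h, h'⟩ hn⟩
    obtain ⟨hn, hn3⟩ := hn
    have hNle : (N n : ℝ) ≤ ν * n := Nat.floor_le (by positivity)
    have hNge : ν * n - 1 ≤ N n := (Nat.sub_one_lt_floor _).le
    have hKle : (K n : ℝ) ≤ n * R + 1 := (Nat.ceil_lt_add_one (by positivity)).le
    have hLle : (L n : ℝ) ≤ η / 4 * n - 3 := Nat.floor_le (by linarith)
    have hN2 : 2 * N n ≤ n := by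
      rw [← Nat.cast_le (α := ℝ)]
      push_cast
      have : 0 ≤ ν * n * (δ + δ ^ 3) := by positivity
      have h2 : (n : ℝ) = ν * n * (2 + δ + δ ^ 3) := by
        linear_combination (-(n : ℝ)) * hνs
      linarith
    have hnR : (n : ℝ) * R = (1 - δ ^ 2) * (ν * n) - η * n := by rw [hRη]; ring
    have hηn : 0 < η * n := by positivity
    have hδ2 : 0 ≤ 1 - δ ^ 2 := by nlinarith
    obtain ⟨c, hc⟩ := exists_code_errorProb_le C (N := N n) (K := K n) (L := L n) (hM n) (hMK n)
      (q := 4 * (1 / ((η / 4) ^ 2 * n)))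
      (measureReal_not_typical_le hcorr hδ hδF hδFF hδ12 hn hN2 (by positivity) (by
        have := mul_le_mul_of_nonneg_left hNge hδ2
        nlinarith) (by
        have h2 : (n : ℝ) = ν * n * (2 + δ + δ ^ 3) := by
          linear_combination (-(n : ℝ)) * hνs
        have h3 := mul_le_mul_of_nonneg_left hNle
          (by nlinarith [pow_nonneg hδ0 3] : 0 ≤ (1 - δ) * (1 + δ ^ 3))
        have h4 : (1 - δ) * (n : ℝ) = (1 - δ) * (ν * n * (2 + δ + δ ^ 3)) := by rw [← h2]
        nlinarith))
    exact ⟨c, fun _ _ => hc⟩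
  choose c hc using hcode
  refine ⟨hR, hR, c, fun i => ?_⟩
  have hηn : Tendsto (fun n : ℕ => η / 4 * (n : ℝ)) atTop atTop :=
    tendsto_natCast_atTop_atTop.const_mul_atTop (by positivity)
  have hlim : Tendsto (fun n : ℕ => 2 * (4 * (1 / ((η / 4) ^ 2 * (n : ℝ))) + 2 * (1 / 2) ^ L n))
      atTop (𝓝 0) := by
    rw [show (0 : ℝ) = 2 * (4 * 0 + 2 * 0) by norm_num]
    refine ((Tendsto.const_mul 4 ?_).add (Tendsto.const_mul 2 ?_)).const_mul 2
    · exact tendsto_const_nhds.div_atTop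
        (tendsto_natCast_atTop_atTop.const_mul_atTop (by positivity))
    · exact (tendsto_pow_atTop_nhds_zero_of_lt_one (by norm_num) (by norm_num)).comp
        (tendsto_nat_floor_atTop.comp (tendsto_atTop_add_const_right _ (-3) hηn))
  refine squeeze_zero' (.of_forall fun n => ?_) ?_ hlim
  · exact div_nonneg (Finset.sum_nonneg fun _ _ => measureReal_nonneg)
      (Finset.prod_nonneg fun _ _ => Nat.cast_nonneg _)
  · filter_upwards [eventually_gt_atTop 0, hηn.eventually_ge_atTop 3] with n h1 h2
    exact hc n h1 h2 i

/-- At rate zero there is a single message for each receiver. -/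
theorem achievable_zero (C : Channel) : C.Achievable (0, 0) := by
  have hM : ∀ (n : ℕ) (i : User),
      ![⌈(2 : ℝ) ^ ((n : ℝ) * 0)⌉₊, ⌈(2 : ℝ) ^ ((n : ℝ) * 0)⌉₊] i = 1 := by
    intro n i
    fin_cases i <;> simp
  refine ⟨le_rfl, le_rfl, fun n =>
    ⟨fun _ _ _ _ => 0, fun i _ _ _ _ => ⟨0, (hM n i).symm ▸ Nat.one_pos⟩⟩, fun i => ?_⟩
  have h0 : ∀ n (c : Code n ![⌈(2 : ℝ) ^ ((n : ℝ) * 0)⌉₊, ⌈(2 : ℝ) ^ ((n : ℝ) * 0)⌉₊]),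
      c.errorProb C i = 0 := by
    intro n c
    have : Subsingleton (Fin (![⌈(2 : ℝ) ^ ((n : ℝ) * 0)⌉₊, ⌈(2 : ℝ) ^ ((n : ℝ) * 0)⌉₊] i)) := by
      rw [hM]; infer_instance
    have hempty : ∀ w, {σ | c.estimate w σ i ≠ w i} = ∅ := fun w =>
      Set.eq_empty_of_forall_notMem fun σ hσ => hσ (Subsingleton.elim _ _)
    simp only [Code.errorProb, hempty, measureReal_empty, Finset.sum_const_zero, zero_div]
  simp [h0]

end IntermittentBC
end

theorem theorem3 (C : IntermittentBC.Channel) (δ : ℝ)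
    (hcorr : ∀ᵐ f ∂C.feedbackLaw.toMeasure, ∀ i, f.1 i = f.2 i)
    (hδ : ∀ i, C.erasure i = δ)
    (hδF : ∀ i, C.feedbackErasure i = δ)
    (hδFF : C.jointFeedbackErasure = δ ^ 2)
    (hδ12 : C.jointErasure = δ ^ 2) :
    ((1 - δ ^ 2) / (2 + δ + δ ^ 3), (1 - δ ^ 2) / (2 + δ + δ ^ 3)) ∈ C.capacityRegion := by
  set ρ := (1 - δ ^ 2) / (2 + δ + δ ^ 3) with hρ
  have hδ0 : 0 ≤ δ := hδ 0 ▸ measureReal_nonneg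
  have hδ1 : δ ≤ 1 := hδ 0 ▸ measureReal_le_one
  have hρ0 : 0 ≤ ρ := div_nonneg (by nlinarith) (by positivity)
  -- For `δ = 1` there is no nonnegative rate below the claimed one.
  rcases hρ0.eq_or_lt with h | h
  · rw [← h]
    exact subset_closure (IntermittentBC.achievable_zero C)
  · have hmem : ρ ∈ closure (Set.Ico 0 ρ) := by
      rw [closure_Ico h.ne]; exact ⟨hρ0, le_rfl⟩
    have hcont : Continuous fun r : ℝ => (r, r) := by fun_prop
    have hmaps : Set.MapsTo (fun r : ℝ => (r, r)) (Set.Ico 0 ρ) {R | C.Achievable R} := fun r hr =>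
      IntermittentBC.achievable_of_lt hcorr hδ hδF hδFF hδ12 hr.1 hr.2
    exact map_mem_closure (f := fun r : ℝ => (r, r)) hcont hmem hmaps
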